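/- **Conventions.** Let $[n]=\{1,\dots,n\}$ and let $\binom{[n]}{k}$ be the family of $k$-element subsets of $[n]$. For $S,T\in\binom{[n]}{k}$ write $S<_{\mathrm{lex}}T$ iff $S\neq T$ and $\min(S\triangle T)\in S$. A $k$-uniform hypergraph $H\subseteq\binom{[n]}{k}$ is *shifted* if $(S\setminus\{j\})\cup\{i\}\in H$ whenever $i<j$, $j\in S\in H$ and $i\notin S$. It is an *initial lex-segment* if $H=\{T'\in\binom{[n]}{k}: T'\le_{\mathrm{lex}}T\}$ for some $T\in\binom{[n]}{k}$. Let $\mathbb F$ be a field, $\mathbb L$ a field extension of $\mathbb F$, and $X=(x_{ij})$ an $n\times n$ matrix over $\mathbb L$ whose entries are algebraically independent over $\mathbb F$. For $S,T\in\binom{[n]}{k}$ let $X_{ST}$ be the $k\times k$ minor of $X$ with rows $S$ and columns $T$. For $G\subseteq\binom{[n]}{k}$ the *exterior shifting* $\Delta^e(G)$ is the set of those $T\in\binom{[n]}{k}$ for which the vector $(X_{ST})_{S\in G}\in\mathbb L^{G}$ does not lie in the linear span of the vectors $(X_{ST'})_{S\in G}$ with $T'<_{\mathrm{lex}}T$.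 A shifted $H\subseteq\binom{[n]}{k}$ is *matroidal* if $M(H)=\{G\subseteq\binom{[n]}{k}:\Delta^e(G)=H\}$ is the set of bases of a matroid with ground set $\binom{[n]}{k}$. For nonempty $H\subseteq\binom{[n]}{k}$ let $m_H$ be its lexicographic maximum. The set $s_H\in\binom{[n]}{k}$ is defined as follows, where $A$ denotes a possibly empty set of positive integers, all smaller than $c-1$. * If $\max m_H\neq n$ and $m_H=A\cup\{c,c+1,\dots,c+l\}\cup\{d\}$ with $l\ge 0$, $c+l<d<n$ and $c>1$, then $s_H=A\cup\{c-1\}\cup\{n-(l+1),n-l,\dots,n-1\}$. * If $\max m_H=n$ and $m_H=A\cup\{c,c+1,\dots,c+l\}\cup\{n-r,n-r+1,\dots,n\}$ with $l,r\ge 0$, $c+l<n-r-1$ and $c>1$, then $s_H=A\cup\{c-1\}\cup\{n-r-l,n-r-l+1,\dots,n\}$. If $k\ge 2$, the numbers $c,l,d$ (resp. $c,l,r$) and the set $A$ are determined by $m_H$. The set $s_H$ is undefined exactly when the presentation of $m_H$ has $c=1$ or when $m_H=\{n-k+1,\dots,n\}$; in these cases the condition $s_H\notin H$ below is regarded as satisfied.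 **Theorem.** Let $k\ge 4$ and let $H\subseteq\binom{[n]}{k}$ be a nonempty shifted $k$-uniform hypergraph such that $s_H\notin H$. Then $H$ is matroidal if and only if $H$ is an initial lex-segment. -/

import Mathlib

/-!
Exterior algebraic shifting of uniform hypergraphs, shiftedness, the lexicographic order,
matroidality, and the explicit set attached to a lex-maximal hyperedge.

For a linearly ordered vertex type `V`, the type of `k`-subsets of `V` is Mathlib's
`Set.powersetCard V k`, and a `k`-uniform hypergraph on `V` is a set of such `k`-subsets.
-/

namespace ExteriorShifting

/-- The vertex set `[n] = {1, 2, …, n}`, as a linearly ordered finite type. -/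
abbrev Vertex (n : ℕ) : Type := Finset.Icc 1 n

/-- The family of all `k`-subsets of `V`, as a type. -/
abbrev KSubset (V : Type*) (k : ℕ) : Type _ := Set.powersetCard V k

section General

variable {V : Type*} [LinearOrder V] {k : ℕ}

/-- `S <_lex T`: the least element `a` of the symmetric difference of `S` and `T` lies in `S`,
i.e. `a ∈ S \ T` and `S` and `T` have the same elements below `a`. -/
def LexLT (S T : KSubset V k) : Prop :=
  ∃ a, a ∈ S.1 ∧ a ∉ T.1 ∧ ∀ b, b < a → (b ∈ S.1 ↔ b ∈ T.1)

/-- `S ≤_lex T`. -/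
def LexLE (S T : KSubset V k) : Prop :=
  LexLT S T ∨ S = T

/-- `H` is shifted: replacing an element `j` of a hyperedge by a smaller vertex `i` that is not in
the hyperedge gives again a hyperedge. -/
def IsShifted (H : Set (KSubset V k)) : Prop :=
  ∀ S ∈ H, ∀ i j : V, i < j → j ∈ S.1 → i ∉ S.1 →
    ∀ T : KSubset V k, T.1 = insert i (S.1.erase j) → T ∈ H

/-- `H` consists of all `k`-sets that are lexicographically at most some fixed `k`-set. -/
def IsInitialLexSegment (H : Set (KSubset V k)) : Prop :=
  ∃ T : KSubset V k, H = {T' | LexLE T' T}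

/-- `m` is the lexicographic maximum of `H`. -/
def IsLexMax (H : Set (KSubset V k)) (m : KSubset V k) : Prop :=
  m ∈ H ∧ ∀ S ∈ H, LexLE S m

variable {L : Type*} [Field L]

/-- The `k × k` minor `X_{ST}` of `X` with rows `S` and columns `T` (both in increasing order),
i.e. the `(S, T)` entry of the `k`-th compound matrix of `X`. -/
noncomputable def minor (X : Matrix V V L) (S T : KSubset V k) : L :=
  (X.submatrix (Set.powersetCard.ofFinEmbEquiv.symm S)
    (Set.powersetCard.ofFinEmbEquiv.symm T)).det

/-- The column with index `T` of the submatrix of the `k`-th compound matrix of `X` whose rows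
are indexed by the hyperedges of `G`. -/
noncomputable def compoundColumn (X : Matrix V V L) (G : Set (KSubset V k)) (T : KSubset V k) :
    G → L :=
  fun S => minor X S.1 T

/-- The exterior shifting `Δᵉ(G)`, computed with the matrix `X`: the indices of the columns which
are not spanned by the lexicographically previous columns, i.e. of the basis of the
column space chosen greedily. (For `X` generic over the base field, this is exterior shifting.) -/
noncomputable def exteriorShift (X : Matrix V V L) (G : Set (KSubset V k)) :
    Set (KSubset V k) :=
  {T | compoundColumn X G T ∉
    Submodule.span L (compoundColumn X G '' {T' | LexLT T' T})}

/-- `M(H)`: all `k`-uniform hypergraphs whose exterior shifting is `H`. -/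
def shiftingFiber (X : Matrix V V L) (H : Set (KSubset V k)) : Set (Set (KSubset V k)) :=
  {G | exteriorShift X G = H}

/-- `H` is matroidal: `M(H)` is the set of bases of a matroid whose ground set is the set of all
`k`-subsets of `V`. -/
def IsMatroidal (X : Matrix V V L) (H : Set (KSubset V k)) : Prop :=
  ∃ N : Matroid (KSubset V k), N.E = Set.univ ∧
    ∀ B : Set (KSubset V k), N.IsBase B ↔ B ∈ shiftingFiber X H

end General

/-- `X` is generic over `F`: its entries are algebraically independent over `F`. -/
def IsGeneric (F : Type*) {V L : Type*} [Field F] [Field L] [Algebra F L]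
    (X : Matrix V V L) : Prop :=
  AlgebraicIndependent F (fun p : V × V => X p.1 p.2)

/-- The set of natural numbers underlying a `k`-subset of `[n]`. -/
def values {n k : ℕ} (S : KSubset (Vertex n) k) : Finset ℕ :=
  S.1.map (Function.Embedding.subtype _)

/-- `IsSpecialSet n m s` says that `s` is the set `s_H` built from the lex-maximum `m = m_H` of a
hypergraph on `[n]`. Here `A` is the (possibly empty) set `{a, …, b}`, with `b < c - 1`.

* If `max m ≠ n`, then `m = {a, …, b, c, c + 1, …, c + l, d}` and
  `s = {a, …, b, c - 1, n - (l + 1), n - l, …, n - 1}`.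
* If `max m = n`, then `m = {a, …, b, c, c + 1, …, c + l, n - r, …, n}` with `c + l < n - r - 1`
  and `s = {a, …, b, c - 1, n - r - l, …, n}`.

In both cases `c > 1` is required. When `m` has no such presentation
(for `c = 1`, and for `m = {n - k + 1, …, n}`) there is no such `s`. -/
inductive IsSpecialSet (n : ℕ) : Finset ℕ → Finset ℕ → Prop
  | maxNe (A : Finset ℕ) (c l d : ℕ) (hc : 1 < c) (hA : ∀ x ∈ A, x + 1 < c)
      (hd : c + l < d) (hn : d < n) :
      IsSpecialSet n (A ∪ Finset.Icc c (c + l) ∪ {d})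
        (A ∪ {c - 1} ∪ Finset.Icc (n - (l + 1)) (n - 1))
  | maxEq (A : Finset ℕ) (c l r : ℕ) (hc : 1 < c) (hA : ∀ x ∈ A, x + 1 < c)
      (hr : c + l + 1 + r < n) :
      IsSpecialSet n (A ∪ Finset.Icc c (c + l) ∪ Finset.Icc (n - r) n)
        (A ∪ {c - 1} ∪ Finset.Icc (n - r - l) n)

end ExteriorShifting

/-! Two orders interact: the lexicographic order used by the greedy basis, and the
weaker-to-satisfy-by-shifting componentwise order `CompLE`, which implies it. Shifted families are
the `CompLE` down-sets. Write generic `X` as lower times upper triangular; by Cauchy–Binet its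
compound matrix factors into pieces supported on `CompLE`. Hence each member of a shifting lies
below some member of `G`, and a shifted family is its own shifting.

If `H` is an initial lex-segment, the shifting of `G` is `H` exactly when the columns in `H` form a
basis of the space indexed by `G`. The block of minors with rows `G` and columns `H` is then square
and invertible, so `G` is a row basis: `M(H)` consists of the bases of a vector matroid.

Conversely, suppose `M(H)` is matroidal. Permuting vertices preserves genericity, so `H` and `σ(H)`
are both bases. Exchanging `m = m_H` out of `H` brings in some `σ(S)` with `S ∈ H`, and the new
basis still has shifting `H`, which contains `m`; this forces `m ≤ σ(S)` componentwise. If that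
implies `s ≤ σ(S)` for some `s ∉ H` lexicographically before `m`, specializing `X` shows that column
`s` is independent of the earlier columns in `H`, a contradiction (`IsGeneric.not_isMatroidal`).
With `s = s_H`, a suitable `σ` reverses an interval starting at the run `[c, c + l]` of `m`. When
`s_H` is undefined, every set lexicographically at most `m` is already componentwise at most `m`, so
`H` is an initial segment. -/

namespace ExteriorShifting

/-! ### Lexicographic and componentwise orders -/

section Orders

variable {V : Type*} [LinearOrder V] {k : ℕ}

/-- The componentwise order on `k`-subsets, expressed through the counting functions. -/
def CompLE (S T : KSubset V k) : Prop :=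
  ∀ v, (T.1.filter (· ≤ v)).card ≤ (S.1.filter (· ≤ v)).card

theorem CompLE.refl (S : KSubset V k) : CompLE S S := fun _ => le_rfl

/-- This turns a first disagreement into a count inequality, the bridge between the two orders. -/
theorem filter_card_eq_add_one {S T : Finset V} {a : V} (haS : a ∈ S) (haT : a ∉ T)
    (h : ∀ b, b < a → (b ∈ S ↔ b ∈ T)) :
    (S.filter (· ≤ a)).card = (T.filter (· ≤ a)).card + 1 := by
  have : S.filter (· ≤ a) = insert a (T.filter (· ≤ a)) := by
    ext x
    simp only [Finset.mem_filter, Finset.mem_insert]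
    rcases lt_trichotomy x a with hx | rfl | hx
    · simp [h x hx, hx.ne]
    · simp [haS]
    · simp [hx.ne', hx.not_ge]
  rw [this, Finset.card_insert_of_notMem (by simp [haT])]

theorem lexLT_trichotomy (S T : KSubset V k) : LexLT S T ∨ S = T ∨ LexLT T S := by
  by_cases h : S = T
  · exact Or.inr (Or.inl h)
  have hne : (symmDiff S.1 T.1).Nonempty := by
    rw [Finset.nonempty_iff_ne_empty]
    intro h0
    exact h (Subtype.ext (symmDiff_eq_bot.1 h0))
  have hmin : ∀ b, b < (symmDiff S.1 T.1).min' hne → (b ∈ S.1 ↔ b ∈ T.1) := by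
    intro b hb
    by_contra hc
    have : b ∈ symmDiff S.1 T.1 := by
      rw [Finset.mem_symmDiff]; tauto
    exact absurd (Finset.min'_le _ b this) (not_le.2 hb)
  rcases Finset.mem_symmDiff.1 (Finset.min'_mem _ hne) with ⟨h1, h2⟩ | ⟨h1, h2⟩
  · exact Or.inl ⟨_, h1, h2, hmin⟩
  · exact Or.inr (Or.inr ⟨_, h1, h2, fun b hb => (hmin b hb).symm⟩)

theorem LexLT.irrefl (S : KSubset V k) : ¬ LexLT S S := fun ⟨_, h1, h2, _⟩ => h2 h1

theorem LexLT.trans {S T U : KSubset V k} (h1 : LexLT S T) (h2 : LexLT T U) : LexLT S U := by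
  obtain ⟨a, haS, haT, ha⟩ := h1
  obtain ⟨b, hbT, hbU, hb⟩ := h2
  rcases lt_trichotomy a b with h | rfl | h
  · exact ⟨a, haS, fun hU => haT ((hb a h).2 hU), fun c hc => (ha c hc).trans (hb c (hc.trans h))⟩
  · exact absurd hbT haT
  · exact ⟨b, (ha b h).2 hbT, hbU, fun c hc => (ha c (hc.trans h)).trans (hb c hc)⟩

theorem LexLT.not_lexLE {S T : KSubset V k} (h : LexLT S T) : ¬ LexLE T S := by
  rintro (h' | rfl)
  · exact LexLT.irrefl _ (h.trans h')
  · exact LexLT.irrefl _ h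

theorem lexLT_of_not_lexLE {S T : KSubset V k} (h : ¬ LexLE S T) : LexLT T S := by
  rcases lexLT_trichotomy S T with h' | h' | h'
  · exact absurd (Or.inl h') h
  · exact absurd (Or.inr h') h
  · exact h'

theorem LexLE.trans_lt {S T U : KSubset V k} (h1 : LexLE S T) (h2 : LexLT T U) : LexLT S U := by
  rcases h1 with h | rfl
  · exact h.trans h2
  · exact h2

theorem wellFounded_lexLT [Finite V] : WellFounded (LexLT : KSubset V k → KSubset V k → Prop) :=
  haveI : IsTrans (KSubset V k) LexLT := ⟨fun _ _ _ => LexLT.trans⟩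
  haveI : Std.Irrefl (LexLT : KSubset V k → KSubset V k → Prop) := ⟨LexLT.irrefl⟩
  Finite.wellFounded_of_trans_of_irrefl _

theorem CompLE.lexLE {S T : KSubset V k} (h : CompLE S T) : LexLE S T := by
  by_contra hc
  obtain ⟨a, haT, haS, hb⟩ := lexLT_of_not_lexLE hc
  have := filter_card_eq_add_one haT haS hb
  have := h a
  omega

theorem CompLE.lexLT_of_ne {S T : KSubset V k} (h : CompLE S T) (hne : S ≠ T) : LexLT S T :=
  h.lexLE.resolve_right hne

theorem CompLE.apply_le {S T : KSubset V k} (h : CompLE S T) (i : Fin k) :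
    Set.powersetCard.ofFinEmbEquiv.symm S i ≤ Set.powersetCard.ofFinEmbEquiv.symm T i := by
  rw [Set.powersetCard.ofFinEmbEquiv_symm_apply, Set.powersetCard.ofFinEmbEquiv_symm_apply]
  by_contra! hlt
  set v := Finset.orderEmbOfFin T.1 T.2 i with hv
  have h1 : (i : ℕ) + 1 ≤ (T.1.filter (· ≤ v)).card := by
    rw [← Fin.card_Iic i, ← Finset.card_map (Finset.orderEmbOfFin T.1 T.2).toEmbedding]
    apply Finset.card_le_card
    intro x hx
    obtain ⟨j, hj, rfl⟩ := Finset.mem_map.1 hx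
    refine Finset.mem_filter.2 ⟨Finset.orderEmbOfFin_mem _ _ _, ?_⟩
    exact (Finset.orderEmbOfFin T.1 T.2).monotone (Finset.mem_Iic.1 hj)
  have h2 : (S.1.filter (· ≤ v)).card ≤ (i : ℕ) := by
    rw [← Fin.card_Iio i, ← Finset.card_map (Finset.orderEmbOfFin S.1 S.2).toEmbedding]
    apply Finset.card_le_card
    intro x hx
    obtain ⟨hxS, hxv⟩ := Finset.mem_filter.1 hx
    rw [← Finset.mem_coe, ← Finset.range_orderEmbOfFin S.1 S.2] at hxS
    obtain ⟨j, rfl⟩ := hxS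
    refine Finset.mem_map_of_mem _ (Finset.mem_Iio.2 ?_)
    exact (Finset.orderEmbOfFin S.1 S.2).lt_iff_lt.1 (hxv.trans_lt hlt)
  have := h v
  omega

/-- At the first difference `a ∈ S \ T`, replace the next element `b` of `T` after `a` by `a`. The
result is a lexicographically smaller hyperedge still componentwise above `S`, so induction applies.
-/
theorem IsShifted.mem_of_compLE [Finite V] {H : Set (KSubset V k)} (hH : IsShifted H)
    {S T : KSubset V k} (hT : T ∈ H) (h : CompLE S T) : S ∈ H := by
  revert hT h
  refine wellFounded_lexLT.induction (C := fun T => T ∈ H → CompLE S T → S ∈ H) T ?_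
  intro T ih hT h
  by_cases hne : S = T
  · exact hne ▸ hT
  obtain ⟨a, haS, haT, hab⟩ := h.lexLT_of_ne hne
  have hcard := filter_card_eq_add_one haS haT hab
  have hne : (T.1.filter (a < ·)).Nonempty := by
    by_contra h0
    rw [Finset.not_nonempty_iff_eq_empty, Finset.filter_eq_empty_iff] at h0
    have h1 : T.1.filter (· ≤ a) = T.1 := Finset.filter_true_of_mem fun x hx => not_lt.1 (h0 hx)
    have h2 := Finset.card_filter_le S.1 (· ≤ a)
    rw [h1] at hcard
    have h3 : T.1.card = k := T.2
    have h4 : S.1.card = k := S.2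
    omega
  set b := (T.1.filter (a < ·)).min' hne with hb
  obtain ⟨hbT, hlt⟩ := Finset.mem_filter.1 (Finset.min'_mem _ hne)
  rw [← hb] at hbT hlt
  have hgap : ∀ x ∈ T.1, a < x → b ≤ x := fun x hx hax =>
    Finset.min'_le _ _ (Finset.mem_filter.2 ⟨hx, hax⟩)
  have ha' : a ∉ T.1.erase b := fun h' => haT (Finset.mem_of_mem_erase h')
  let T' : KSubset V k := ⟨insert a (T.1.erase b), by
    have h3 : T.1.card = k := T.2
    have : 0 < T.1.card := Finset.card_pos.2 ⟨b, hbT⟩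
    rw [Set.powersetCard.mem_iff, Finset.card_insert_of_notMem ha', Finset.card_erase_of_mem hbT]
    omega⟩
  have hT' : T'.1 = insert a (T.1.erase b) := rfl
  refine ih T' ⟨a, by simp [hT'], haT, fun c hc => ?_⟩ (hH T hT a b hlt hbT haT T' rfl) fun v => ?_
  · simp only [hT', Finset.mem_insert, Finset.mem_erase]
    have := (hc.trans hlt).ne
    have := hc.ne
    tauto
  · rw [hT', Finset.filter_insert, Finset.filter_erase]
    split_ifs with hav
    · rw [Finset.card_insert_of_notMem (by simp [haT])]
      by_cases hbv : b ≤ v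
      · rw [Finset.card_erase_of_mem (by simp [hbT, hbv])]
        have : 0 < (T.1.filter (· ≤ v)).card := Finset.card_pos.2 ⟨b, by simp [hbT, hbv]⟩
        have := h v
        omega
      -- For `a ≤ v < b` the set `T` has nothing in `(a, v]`, so the surplus of `S` at `a` absorbs
      -- the inserted element.
      · have h1 : T.1.filter (· ≤ v) = T.1.filter (· ≤ a) := by
          ext x
          simp only [Finset.mem_filter, and_congr_right_iff]
          intro hx
          refine ⟨fun hxv => ?_, fun hxa => hxa.trans hav⟩
          by_contra! hax
          exact hbv ((hgap x hx hax).trans hxv)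
        have h2 : (S.1.filter (· ≤ a)).card ≤ (S.1.filter (· ≤ v)).card :=
          Finset.card_le_card (Finset.monotone_filter_right _ fun _ _ hx => hx.trans hav)
        have := Finset.card_erase_le (s := T.1.filter (· ≤ v)) (a := b)
        rw [h1] at this ⊢
        omega
    · exact (Finset.card_erase_le).trans (h v)

end Orders

/-! ### Minors, Cauchy–Binet and triangular factorization -/

section Compound

variable {V : Type*} [LinearOrder V] {k : ℕ} {L : Type*} [Field L]

theorem mem_orderEmb (S : KSubset V k) (i : Fin k) :
    Set.powersetCard.ofFinEmbEquiv.symm S i ∈ S.1 :=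
  Finset.orderEmbOfFin_mem _ _ _

theorem exists_orderEmb_eq {S : KSubset V k} {v : V} (h : v ∈ S.1) :
    ∃ i, Set.powersetCard.ofFinEmbEquiv.symm S i = v :=
  (Set.powersetCard.mem_range_ofFinEmbEquiv_symm_iff_mem S v).2 h

theorem minor_transpose (X : Matrix V V L) (S T : KSubset V k) :
    minor X.transpose S T = minor X T S := by
  rw [minor, minor, ← Matrix.det_transpose, Matrix.transpose_submatrix, Matrix.transpose_transpose]

theorem card_filter_orderEmb (S : KSubset V k) (v : V) :
    (Finset.univ.filter fun i => Set.powersetCard.ofFinEmbEquiv.symm S i ≤ v).card =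
      (S.1.filter (· ≤ v)).card := by
  rw [← Finset.card_map (Set.powersetCard.ofFinEmbEquiv.symm S).toEmbedding]
  congr 1
  ext x
  simp only [Finset.mem_map, Finset.mem_filter, Finset.mem_univ, true_and]
  constructor
  · rintro ⟨i, hi, rfl⟩
    exact ⟨mem_orderEmb S i, hi⟩
  · rintro ⟨hx, hxv⟩
    obtain ⟨i, rfl⟩ := exists_orderEmb_eq hx
    exact ⟨i, hxv, rfl⟩

/-- A nonzero Leibniz term matches every element of `S` with an element of `T` that is no larger,
which compares the counts. -/
theorem compLE_of_minor_ne_zero {B : Matrix V V L} (hB : ∀ i j, i < j → B i j = 0)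
    {S T : KSubset V k} (h : minor B S T ≠ 0) : CompLE T S := by
  intro v
  rw [minor, Matrix.det_apply] at h
  obtain ⟨σ, -, hσ⟩ := Finset.exists_ne_zero_of_sum_ne_zero h
  have hσ' : ∀ i, B (Set.powersetCard.ofFinEmbEquiv.symm S (σ i))
      (Set.powersetCard.ofFinEmbEquiv.symm T i) ≠ 0 := by
    intro i hi
    apply hσ
    rw [Finset.prod_eq_zero (Finset.mem_univ i) (by simpa using hi), smul_zero]
  rw [← card_filter_orderEmb, ← card_filter_orderEmb,
    ← Finset.card_map (Equiv.toEmbedding σ.symm)]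
  apply Finset.card_le_card
  intro i hi
  obtain ⟨j, hj, rfl⟩ := Finset.mem_map.1 hi
  simp only [Finset.mem_filter, Finset.mem_univ, true_and, Equiv.coe_toEmbedding] at hj ⊢
  refine le_trans ?_ hj
  by_contra! hlt
  exact hσ' (σ.symm j) (hB _ _ (by simpa using hlt))

theorem compLE_of_minor_ne_zero' {U : Matrix V V L} (hU : ∀ i j, j < i → U i j = 0)
    {S T : KSubset V k} (h : minor U S T ≠ 0) : CompLE S T :=
  compLE_of_minor_ne_zero (B := U.transpose) (fun i j hij => hU j i hij)
    (by rwa [minor_transpose])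

theorem minor_self_ne_zero {U : Matrix V V L} (hU : ∀ i j, j < i → U i j = 0)
    (hd : ∀ i, U i i ≠ 0) (S : KSubset V k) : minor U S S ≠ 0 := by
  rw [minor, Matrix.det_of_isUpperTriangular]
  · exact Finset.prod_ne_zero_iff.2 fun i _ => hd _
  · intro i j hij
    exact hU _ _ ((Set.powersetCard.ofFinEmbEquiv.symm S).strictMono hij)

variable [Fintype V]

/-- Minors are coordinates of wedges of rows, so Cauchy–Binet becomes functoriality of the exterior
power. -/
theorem minor_eq_repr (X : Matrix V V L) (S T : KSubset V k) :
    minor X S T = ((Pi.basisFun L V).exteriorPower k).repr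
      (exteriorPower.ιMulti L k (X ∘ Set.powersetCard.ofFinEmbEquiv.symm S)) T := by
  rw [exteriorPower.basis_repr_apply, exteriorPower.ιMultiDual_apply_ιMulti]
  rfl

/-- The Cauchy–Binet formula. -/
theorem minor_mul (A B : Matrix V V L) (S T : KSubset V k) :
    minor (A * B) S T = ∑ U, minor A S U * minor B U T := by
  have h1 : ((A * B) ∘ Set.powersetCard.ofFinEmbEquiv.symm S : Fin k → V → L) =
      B.vecMulLinear ∘ (A ∘ Set.powersetCard.ofFinEmbEquiv.symm S) := by
    funext i
    exact Matrix.mul_apply_eq_vecMul A B _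
  have h2 : ∀ U : KSubset V k, (B.vecMulLinear ∘
      (Pi.basisFun L V ∘ Set.powersetCard.ofFinEmbEquiv.symm U) : Fin k → V → L) =
      B ∘ Set.powersetCard.ofFinEmbEquiv.symm U := by
    intro U
    funext i
    change Matrix.vecMul (Pi.basisFun L V _) B = B _
    rw [Pi.basisFun_apply, Matrix.single_one_vecMul]
    rfl
  rw [minor_eq_repr, h1, ← exteriorPower.map_apply_ιMulti,
    ← ((Pi.basisFun L V).exteriorPower k).sum_repr
      (exteriorPower.ιMulti L k (A ∘ Set.powersetCard.ofFinEmbEquiv.symm S)), map_sum, map_sum,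
    Finsupp.finsetSum_apply]
  refine Finset.sum_congr rfl fun U _ => ?_
  rw [map_smul, map_smul, Finsupp.smul_apply, smul_eq_mul, ← minor_eq_repr,
    exteriorPower.basis_apply, exteriorPower.ιMulti_family, exteriorPower.map_apply_ιMulti, h2,
    ← minor_eq_repr]

theorem minor_one (S T : KSubset V k) :
    minor (1 : Matrix V V L) S T = if S = T then 1 else 0 := by
  have h : ((1 : Matrix V V L) ∘ Set.powersetCard.ofFinEmbEquiv.symm S : Fin k → V → L) =
      Pi.basisFun L V ∘ Set.powersetCard.ofFinEmbEquiv.symm S := by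
    ext i j
    change (1 : Matrix V V L) _ j = Pi.basisFun L V _ j
    simp [Matrix.one_apply, Pi.single_apply, eq_comm]
  rw [minor_eq_repr, h]
  exact (DFunLike.congr_fun (exteriorPower.basis_repr L k (Pi.basisFun L V) S) T).trans
    (Finsupp.single_apply)

/-- The `k`-th compound matrix. -/
noncomputable def compound (k : ℕ) (X : Matrix V V L) : Matrix (KSubset V k) (KSubset V k) L :=
  Matrix.of (minor X)

theorem compound_mul (A B : Matrix V V L) : compound k (A * B) = compound k A * compound k B := by
  ext S T
  exact minor_mul A B S T

theorem compound_one : compound k (1 : Matrix V V L) = 1 := by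
  ext S T
  exact (minor_one S T).trans (Matrix.one_apply).symm

/-- `LU`-decomposition of a matrix with nonvanishing leading principal minors. -/
theorem exists_lower_upper (X : Matrix V V L) (hdet : X.det ≠ 0)
    (hX : ∀ i : V, (X.submatrix (Subtype.val : {j // j < i} → V) Subtype.val).det ≠ 0) :
    ∃ P Q U : Matrix V V L, X = P * U ∧ U = Q * X ∧ (∀ i j, i < j → P i j = 0) ∧
      (∀ i j, i < j → Q i j = 0) ∧ (∀ i j, j < i → U i j = 0) ∧ ∀ i, U i i ≠ 0 := by
  have h1 : ∀ i : V, ∃ q : V → L, q i = 1 ∧ (∀ j, i < j → q j = 0) ∧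
      ∀ j, j < i → ∑ l, q l * X l j = 0 := by
    intro i
    set Y := X.submatrix (Subtype.val : {j // j < i} → V) Subtype.val with hY
    have hu : IsUnit Y.det := isUnit_iff_ne_zero.2 (hX i)
    -- Gaussian elimination: these multiples of the earlier rows clear row `i` to the left of the
    -- diagonal.
    let b : {j // j < i} → L := Matrix.vecMul (fun j : {j // j < i} => - X i j) Y⁻¹
    have hb : Matrix.vecMul b Y = fun j : {j // j < i} => - X i j := by
      simp only [b, Matrix.vecMul_vecMul, Matrix.nonsing_inv_mul _ hu, Matrix.vecMul_one]
    let q : V → L := fun j => if h : j < i then b ⟨j, h⟩ else if j = i then 1 else 0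
    have hq : q i = 1 := by simp [q]
    have hq' : ∀ j, i < j → q j = 0 := fun j hj => by simp [q, hj.not_gt, hj.ne']
    refine ⟨q, hq, hq', fun j hj => ?_⟩
    have h2 := congrFun hb ⟨j, hj⟩
    simp only [Matrix.vecMul, dotProduct, hY, Matrix.submatrix_apply] at h2
    rw [← Finset.sum_filter_add_sum_filter_not _ (· < i),
      Finset.sum_subtype (p := (· < i)) _ (by simp),
      Finset.sum_eq_single_of_mem i (by simp), hq, one_mul, ← eq_neg_iff_add_eq_zero, ← h2]
    · exact Finset.sum_congr rfl fun l _ => by simp [q, l.2]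
    · intro l hl hne
      have : i < l := lt_of_le_of_ne (by simpa using hl) hne.symm
      rw [hq' l this, zero_mul]
  choose Q hQ1 hQ2 hQ3 using h1
  have hQtri : (Matrix.of Q).BlockTriangular OrderDual.toDual := fun i j hij => hQ2 i j hij
  have hQdet : (Matrix.of Q).det = 1 := by
    rw [Matrix.det_of_isLowerTriangular _ hQtri]
    exact Finset.prod_eq_one fun i _ => hQ1 i
  have hQu : IsUnit (Matrix.of Q).det := by simp [hQdet]
  let _ := Matrix.invertibleOfIsUnitDet _ hQu
  have hU : ∀ i j, j < i → (Matrix.of Q * X) i j = 0 := fun i j hij => by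
    rw [Matrix.mul_apply]
    exact hQ3 i j hij
  refine ⟨(Matrix.of Q)⁻¹, Matrix.of Q, Matrix.of Q * X, ?_, rfl, ?_, hQ2, hU, ?_⟩
  · rw [← Matrix.mul_assoc, Matrix.nonsing_inv_mul _ hQu, Matrix.one_mul]
  · intro i j hij
    exact Matrix.blockTriangular_inv_of_blockTriangular hQtri hij
  · have h4 : (Matrix.of Q * X).det ≠ 0 := by rwa [Matrix.det_mul, hQdet, one_mul]
    rw [Matrix.det_of_isUpperTriangular fun i j hij => hU i j hij] at h4
    exact fun i => Finset.prod_ne_zero_iff.1 h4 i (Finset.mem_univ i)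

end Compound

/-! ### Exterior shifting through row combinations -/

section Shift

variable {V : Type*} [LinearOrder V] {k : ℕ} {L : Type*} [Field L]

theorem compoundColumn_mem_span [Finite V] (X : Matrix V V L) (G : Set (KSubset V k))
    (T : KSubset V k) :
    compoundColumn X G T ∈
      Submodule.span L (compoundColumn X G '' {T' | T' ∈ exteriorShift X G ∧ LexLE T' T}) := by
  refine wellFounded_lexLT.induction (C := fun T => compoundColumn X G T ∈
      Submodule.span L (compoundColumn X G '' {T' | T' ∈ exteriorShift X G ∧ LexLE T' T})) T ?_
  intro T ih
  by_cases hT : T ∈ exteriorShift X G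
  · exact Submodule.subset_span ⟨T, ⟨hT, Or.inr rfl⟩, rfl⟩
  · refine (Submodule.span_le.2 ?_) (not_not.1 hT)
    rintro _ ⟨T', hT', rfl⟩
    refine Submodule.span_mono (Set.image_mono ?_) (ih T' hT')
    exact fun U hU => ⟨hU.1, Or.inl (hU.2.trans_lt hT')⟩

variable [Fintype V]

theorem vecMul_compound_apply (X : Matrix V V L) (G : Set (KSubset V k)) [Fintype G]
    {a : KSubset V k → L} (ha : ∀ S, S ∉ G → a S = 0) (T : KSubset V k) :
    Matrix.vecMul a (compound k X) T = ∑ S : G, a S * compoundColumn X G T S := by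
  classical
  rw [Matrix.vecMul, dotProduct, ← Finset.sum_filter_of_ne (p := (· ∈ G)),
    Finset.sum_subtype (p := (· ∈ G)) _ (by simp)]
  · rfl
  · intro S _ hS
    by_contra hc
    exact hS (by rw [ha S hc, zero_mul])

/-- By duality, a column outside a span is detected by a functional, that is, by a combination of
the rows in `G`. Thus the shifting is the set of leading positions of such combinations. -/
theorem mem_exteriorShift_iff {X : Matrix V V L} {G : Set (KSubset V k)} {T : KSubset V k} :
    T ∈ exteriorShift X G ↔ ∃ a : KSubset V k → L, (∀ S, S ∉ G → a S = 0) ∧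
      (∀ T', LexLT T' T → Matrix.vecMul a (compound k X) T' = 0) ∧
      Matrix.vecMul a (compound k X) T ≠ 0 := by
  classical
  let _ : Fintype G := Fintype.ofFinite G
  constructor
  · intro h
    obtain ⟨f, hf, hker⟩ := Submodule.exists_le_ker_of_notMem h
    let a : KSubset V k → L := fun S => if h : S ∈ G then f (Pi.single ⟨S, h⟩ 1) else 0
    have ha : ∀ S, S ∉ G → a S = 0 := fun S hS => dif_neg hS
    have haf : ∀ T', Matrix.vecMul a (compound k X) T' = f (compoundColumn X G T') := by
      intro T'
      rw [vecMul_compound_apply X G ha, LinearMap.pi_apply_eq_sum_univ f]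
      refine Finset.sum_congr rfl fun S _ => ?_
      rw [smul_eq_mul, mul_comm]
      congr 1
      simp only [a, S.2, dif_pos]
      congr 1
      ext S'
      simp [Pi.single_apply, eq_comm]
    refine ⟨a, ha, fun T' hT' => ?_, by rwa [haf]⟩
    rw [haf]
    exact hker (Submodule.subset_span ⟨T', hT', rfl⟩)
  · rintro ⟨a, ha, h0, hT⟩ hmem
    let f : (G → L) →ₗ[L] L := Fintype.linearCombination L (fun S : G => a S)
    have haf : ∀ T', f (compoundColumn X G T') = Matrix.vecMul a (compound k X) T' := by
      intro T'
      rw [vecMul_compound_apply X G ha]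
      simp [f, Fintype.linearCombination_apply, mul_comm]
    have hle : Submodule.span L (compoundColumn X G '' {T' | LexLT T' T}) ≤ f.ker := by
      refine Submodule.span_le.2 ?_
      rintro _ ⟨T', hT', rfl⟩
      exact (haf T').trans (h0 T' hT')
    exact hT ((haf T).symm.trans (hle hmem))

end Shift

/-! ### Consequences of genericity -/

section Generic

variable {F L V : Type*} [Field F] [Field L] [Algebra F L] {X : Matrix V V L}

theorem IsGeneric.submatrix (hX : IsGeneric F X) (σ : V → V) (hσ : Function.Injective σ) :
    IsGeneric F (X.submatrix σ id) :=
  AlgebraicIndependent.comp hX (fun p : V × V => (σ p.1, p.2)) fun p q h => by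
    simp only [Prod.mk.injEq] at h
    exact Prod.ext (hσ h.1) h.2

theorem IsGeneric.aeval_ne_zero (hX : IsGeneric F X) (X₀ : Matrix V V F)
    {p : MvPolynomial (V × V) F} (h : MvPolynomial.aeval (fun q : V × V => X₀ q.1 q.2) p ≠ 0) :
    MvPolynomial.aeval (fun q : V × V => X q.1 q.2) p ≠ 0 := by
  intro h0
  have hp : p = 0 := (algebraicIndependent_iff_injective_aeval.1 hX) (h0.trans (map_zero _).symm)
  exact h (by rw [hp, map_zero])

theorem aeval_det_submatrix {K : Type*} [Field K] [Algebra F K] (Y : Matrix V V K) {ι : Type*}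
    [Fintype ι] [DecidableEq ι] (e f : ι → V) :
    MvPolynomial.aeval (fun q : V × V => Y q.1 q.2)
      ((Matrix.mvPolynomialX V V F).submatrix e f).det = (Y.submatrix e f).det := by
  rw [AlgHom.map_det]
  congr 1
  ext i j
  simp [Matrix.mvPolynomialX]

theorem IsGeneric.det_submatrix_ne_zero [DecidableEq V] (hX : IsGeneric F X) {ι : Type*} [Fintype ι]
    [DecidableEq ι] (e : ι → V) (he : Function.Injective e) : (X.submatrix e e).det ≠ 0 := by
  rw [← aeval_det_submatrix (F := F)]
  -- Specializing to the identity matrix makes every principal minor equal to 1.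
  refine hX.aeval_ne_zero 1 ?_
  rw [aeval_det_submatrix, Matrix.submatrix_one _ he, Matrix.det_one]
  exact one_ne_zero

variable [LinearOrder V] {k : ℕ}

theorem aeval_det_minor {K : Type*} [Field K] [Algebra F K] (Y : Matrix V V K) {ι : Type*}
    [Fintype ι] [DecidableEq ι] (s t : ι → KSubset V k) :
    MvPolynomial.aeval (fun q : V × V => Y q.1 q.2)
      (Matrix.of fun i j => ((Matrix.mvPolynomialX V V F).submatrix
        (Set.powersetCard.ofFinEmbEquiv.symm (s i))
        (Set.powersetCard.ofFinEmbEquiv.symm (t j))).det).det =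
      (Matrix.of fun i j => minor Y (s i) (t j)).det := by
  rw [AlgHom.map_det]
  congr 1
  ext i j
  exact aeval_det_submatrix Y _ _

theorem IsGeneric.det_minor_ne_zero (hX : IsGeneric F X) {ι : Type*} [Fintype ι]
    [DecidableEq ι] (X₀ : Matrix V V F) (s t : ι → KSubset V k)
    (h : (Matrix.of fun i j => minor X₀ (s i) (t j)).det ≠ 0) :
    (Matrix.of fun i j => minor X (s i) (t j)).det ≠ 0 := by
  rw [← aeval_det_minor (F := F)] at h ⊢
  exact hX.aeval_ne_zero X₀ h

/-- For `s ≤ y` componentwise, a lower unitriangular matrix whose minor with rows `y` and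
columns `s` is nonzero. -/
theorem exists_unitriangular_minor_ne_zero (F : Type*) [Field F] {s y : KSubset V k}
    (h : CompLE s y) :
    ∃ B : Matrix V V F, (∀ i j, i < j → B i j = 0) ∧ (∀ i, B i i = 1) ∧ minor B y s ≠ 0 := by
  classical
  set f := Set.powersetCard.ofFinEmbEquiv.symm s
  set g := Set.powersetCard.ofFinEmbEquiv.symm y
  have hfg : ∀ i, f i ≤ g i := fun i => h.apply_le i
  -- Ones are put on the diagonal and where the `i`-th element of `y` meets that of `s`. The chosen
  -- submatrix is upper triangular because `f j ≤ g j < g i` for `j < i`.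
  refine ⟨Matrix.of fun v w => if v = w ∨ ∃ i, v = g i ∧ w = f i then 1 else 0,
    fun v w hvw => ?_, fun v => by simp, ?_⟩
  · rw [Matrix.of_apply, if_neg]
    rintro (rfl | ⟨i, rfl, rfl⟩)
    · exact lt_irrefl _ hvw
    · exact absurd (hfg i) (not_le.2 hvw)
  · rw [minor, Matrix.det_of_isUpperTriangular]
    · refine Finset.prod_ne_zero_iff.2 fun i _ => ?_
      rw [Matrix.submatrix_apply, Matrix.of_apply, if_pos (Or.inr ⟨i, rfl, rfl⟩)]
      exact one_ne_zero
    · intro i j hij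
      rw [Matrix.submatrix_apply, Matrix.of_apply, if_neg]
      rintro (h' | ⟨l, hl, hl'⟩)
      · exact absurd h' ((hfg j).trans_lt (g.strictMono hij)).ne'
      · rw [← g.injective hl] at hl'
        exact absurd (f.injective hl') (ne_of_lt hij)

variable [Fintype V]

theorem IsGeneric.det_ne_zero (hX : IsGeneric F X) : X.det ≠ 0 :=
  hX.det_submatrix_ne_zero id Function.injective_id

theorem IsGeneric.exists_compound_factorization (hX : IsGeneric F X) (k : ℕ) :
    ∃ P Q R : Matrix (KSubset V k) (KSubset V k) L,
      compound k X = P * R ∧ R = Q * compound k X ∧ (∀ S T, P S T ≠ 0 → CompLE T S) ∧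
      (∀ S T, Q S T ≠ 0 → CompLE T S) ∧ (∀ S T, R S T ≠ 0 → CompLE S T) ∧ ∀ S, R S S ≠ 0 := by
  obtain ⟨P, Q, U, hP, hQ, hP', hQ', hU, hU'⟩ := exists_lower_upper X hX.det_ne_zero
    fun i => hX.det_submatrix_ne_zero _ Subtype.val_injective
  exact ⟨compound k P, compound k Q, compound k U, by rw [hP, compound_mul],
    by rw [hQ, compound_mul], fun S T => compLE_of_minor_ne_zero hP',
    fun S T => compLE_of_minor_ne_zero hQ', fun S T => compLE_of_minor_ne_zero' hU,
    fun S => minor_self_ne_zero hU hU' S⟩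

/-- Multiplying by the upper factor `R` does not move the leading position, so `a * P` is already
nonzero at `T`; the support of `P` then supplies `S`. -/
theorem IsGeneric.exists_compLE_of_mem_exteriorShift (hX : IsGeneric F X) {G : Set (KSubset V k)}
    {T : KSubset V k} (hT : T ∈ exteriorShift X G) : ∃ S ∈ G, CompLE T S := by
  obtain ⟨P, Q, R, hXR, -, hP, -, hR, hR'⟩ := hX.exists_compound_factorization k
  obtain ⟨a, ha, ha0, haT⟩ := mem_exteriorShift_iff.1 hT
  set c := Matrix.vecMul a P with hc
  rw [hXR, ← Matrix.vecMul_vecMul, ← hc] at ha0 haT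
  have hrow : ∀ T', (∀ T'', LexLT T'' T' → c T'' = 0) → Matrix.vecMul c R T' = c T' * R T' T' := by
    intro T' h
    refine Finset.sum_eq_single T' (fun S _ hS => ?_) (by simp)
    by_contra hne
    exact left_ne_zero_of_mul hne (h S ((hR S T' (right_ne_zero_of_mul hne)).lexLT_of_ne hS))
  have hc0 : ∀ T', LexLT T' T → c T' = 0 := by
    intro T'
    refine wellFounded_lexLT.induction (C := fun T' => LexLT T' T → c T' = 0) T' ?_
    intro T' ih hT'
    have := hrow T' fun T'' h => ih T'' h (h.trans hT')
    rw [ha0 T' hT'] at this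
    exact (mul_eq_zero.1 this.symm).resolve_right (hR' T')
  rw [hrow T hc0] at haT
  obtain ⟨S, -, hS⟩ := Finset.exists_ne_zero_of_sum_ne_zero (left_ne_zero_of_mul haT)
  refine ⟨S, ?_, hP S T (right_ne_zero_of_mul hS)⟩
  by_contra hSG
  exact left_ne_zero_of_mul hS (ha S hSG)

theorem IsGeneric.exteriorShift_eq_of_isShifted (hX : IsGeneric F X) {H : Set (KSubset V k)}
    (hH : IsShifted H) : exteriorShift X H = H := by
  apply Set.Subset.antisymm
  · intro T hT
    obtain ⟨S, hS, hTS⟩ := hX.exists_compLE_of_mem_exteriorShift hT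
    exact hH.mem_of_compLE hS hTS
  · intro T hT
    obtain ⟨P, Q, R, -, hRQ, -, hQ, hR, hR'⟩ := hX.exists_compound_factorization k
    have hrow : Matrix.vecMul (Q T) (compound k X) = R T := by
      rw [hRQ]
      rfl
    -- Row `T` of `Q` is supported on `CompLE`-smaller sets, hence in `H`, and produces row `T` of
    -- `R`, whose leading position is `T`.
    refine mem_exteriorShift_iff.2 ⟨Q T, fun S hS => ?_, fun T' hT' => ?_, ?_⟩
    · by_contra h
      exact hS (hH.mem_of_compLE hT (hQ T S h))
    · by_contra h
      rw [hrow] at h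
      exact hT'.not_lexLE (hR T T' h).lexLE
    · rw [hrow]
      exact hR' T

/-- If the shifting were `H`, column `s` would be spanned by the earlier columns in `H`. The minors
with rows `y` and the earlier members of `H` contradict this, since their determinant is nonzero
after a specialization. -/
theorem IsGeneric.exteriorShift_ne_of_compLE (hX : IsGeneric F X) {H G : Set (KSubset V k)}
    (hH : IsShifted H) {s y : KSubset V k} (hs : s ∉ H) (hsy : CompLE s y) (hy : y ∈ G)
    (hG : ∀ S ∈ H, LexLT S s → S ∈ G) : exteriorShift X G ≠ H := by
  classical
  intro hshift
  obtain ⟨B, hB, hB1, hBm⟩ := exists_unitriangular_minor_ne_zero F hsy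
  -- The index `none` stands for the row `y` and the column `s`.
  let ι := Option {S // S ∈ H ∧ LexLT S s}
  let r : ι → KSubset V k := fun i => i.elim y Subtype.val
  let c : ι → KSubset V k := fun i => i.elim s Subtype.val
  have hr : ∀ i, r i ∈ G := by
    rintro (_ | ⟨S, hS, hSs⟩)
    · exact hy
    · exact hG S hS hSs
  let _ : Fintype {S // S ∈ H ∧ LexLT S s} := Fintype.ofFinite _
  let _ : Fintype ι := inferInstanceAs (Fintype (Option _))
  have hdet : (Matrix.of fun i j => minor B (r i) (c j)).det ≠ 0 := by
    intro h0
    -- Column `s` vanishes in the rows from `H`, as `s ∉ H` and `H` is a down-set. The block on `H`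
    -- is triangular with nonzero diagonal, so the kernel vector dies there first and then at
    -- `none`.
    obtain ⟨v, hv, hMv⟩ := Matrix.exists_mulVec_eq_zero_iff.2 h0
    have hsome : ∀ S (h : S ∈ H ∧ LexLT S s), v (some ⟨S, h⟩) = 0 := by
      intro S
      refine wellFounded_lexLT.induction
        (C := fun S => ∀ h : S ∈ H ∧ LexLT S s, v (some ⟨S, h⟩) = 0) S ?_
      intro S ih h
      have h1 := congrFun hMv (some ⟨S, h⟩)
      rw [Matrix.mulVec, dotProduct, Finset.sum_eq_single (some ⟨S, h⟩)] at h1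
      · refine (mul_eq_zero.1 h1).resolve_left ?_
        have h2 : minor B.transpose S S ≠ 0 :=
          minor_self_ne_zero (fun i j hij => hB j i hij) (fun i => by simp [hB1]) S
        rwa [minor_transpose] at h2
      · rintro (_ | ⟨S', h'⟩) - hne <;> by_contra hc
        · have := compLE_of_minor_ne_zero hB (left_ne_zero_of_mul hc)
          exact hs (hH.mem_of_compLE h.1 this)
        · have := compLE_of_minor_ne_zero hB (left_ne_zero_of_mul hc)
          refine right_ne_zero_of_mul hc (ih S' (this.lexLT_of_ne ?_) h')
          rintro rfl
          exact hne rfl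
      · simp
    have hnone : v none = 0 := by
      have h1 := congrFun hMv none
      rw [Matrix.mulVec, dotProduct, Finset.sum_eq_single none] at h1
      · exact (mul_eq_zero.1 h1).resolve_left hBm
      · rintro (_ | ⟨S', h'⟩) - hne
        · exact absurd rfl hne
        · rw [hsome S' h', mul_zero]
      · simp
    apply hv
    ext (_ | ⟨S, h⟩)
    · exact hnone
    · exact hsome S h
  have hdet' := hX.det_minor_ne_zero B r c hdet
  have hspan : compoundColumn X G s ∈ Submodule.span L
      (compoundColumn X G '' {T | T ∈ H ∧ LexLT T s}) := by
    have h1 := compoundColumn_mem_span X G s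
    rw [hshift] at h1
    refine Submodule.span_mono (Set.image_mono ?_) h1
    rintro T ⟨hT, hTs | rfl⟩
    · exact ⟨hT, hTs⟩
    · exact absurd hT hs
  rw [Set.image_eq_range] at hspan
  obtain ⟨b, hb⟩ := (Submodule.mem_span_range_iff_exists_fun L).1 hspan
  refine hdet' (Matrix.exists_mulVec_eq_zero_iff.1
    ⟨fun i => i.elim (-1) b, fun h0 => ?_, ?_⟩)
  · have := congrFun h0 none
    simp at this
  · ext i
    have h1 := congrFun hb ⟨r i, hr i⟩
    rw [Finset.sum_apply] at h1
    refine (Fintype.sum_option _).trans ?_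
    change minor X (r i) s * -1 + _ = 0
    rw [mul_neg_one, neg_add_eq_zero]
    refine h1.symm.trans (Finset.sum_congr (Finset.ext fun _ => by simp) fun S _ => ?_)
    exact mul_comm _ _

end Generic

/-! ### Relabelling vertices -/

section Permutation

theorem map_perm_bijective {V : Type*} [Finite V] {k : ℕ} (σ : Equiv.Perm V) :
    Function.Bijective (Set.powersetCard.map k σ.toEmbedding) :=
  Finite.injective_iff_bijective.1 fun _ _ h =>
    Subtype.ext (Finset.map_injective _ (congrArg Subtype.val h))

variable {V : Type*} [LinearOrder V] {k : ℕ} {L : Type*} [Field L]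

/-- The factor is the sign of the permutation that sorts `σ(S)`; it does not depend on `T`, so it
can be absorbed into row coefficients. -/
theorem exists_minor_map (X : Matrix V V L) (σ : Equiv.Perm V) (S : KSubset V k) :
    ∃ ε : L, ∀ T, minor X (Set.powersetCard.map k σ.toEmbedding S) T =
      ε * minor (X.submatrix σ id) S T := by
  set S' := Set.powersetCard.map k σ.toEmbedding S with hS'
  have h1 : ∀ i, ∃ j, Set.powersetCard.ofFinEmbEquiv.symm S' j =
      σ (Set.powersetCard.ofFinEmbEquiv.symm S i) := fun i =>
    exists_orderEmb_eq (Finset.mem_map_of_mem _ (mem_orderEmb S i))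
  choose p hp using h1
  have hinj : Function.Injective p := fun i j hij =>
    (Set.powersetCard.ofFinEmbEquiv.symm S).injective (σ.injective (by rw [← hp, ← hp, hij]))
  let π : Equiv.Perm (Fin k) := Equiv.ofBijective p (Finite.injective_iff_bijective.1 hinj)
  refine ⟨((Equiv.Perm.sign π : ℤ) : L), fun T => ?_⟩
  have h2 : (X.submatrix σ id).submatrix (Set.powersetCard.ofFinEmbEquiv.symm S)
      (Set.powersetCard.ofFinEmbEquiv.symm T) =
      (X.submatrix (Set.powersetCard.ofFinEmbEquiv.symm S')
        (Set.powersetCard.ofFinEmbEquiv.symm T)).submatrix π id := by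
    ext i j
    exact congrArg (X · _) (hp i).symm
  rw [minor, minor, h2, Matrix.det_permute, ← mul_assoc, ← Int.cast_mul, ← Units.val_mul,
    Int.units_mul_self]
  simp

variable [Fintype V]

theorem exteriorShift_image_subset (X : Matrix V V L) (σ : Equiv.Perm V) (G : Set (KSubset V k)) :
    exteriorShift X (Set.powersetCard.map k σ.toEmbedding '' G) ⊆
      exteriorShift (X.submatrix σ id) G := by
  intro T hT
  obtain ⟨a, ha, h0, hne⟩ := mem_exteriorShift_iff.1 hT
  choose ε hε using exists_minor_map (k := k) X σ
  have key : ∀ T', Matrix.vecMul (fun S => ε S * a (Set.powersetCard.map k σ.toEmbedding S))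
      (compound k (X.submatrix σ id)) T' = Matrix.vecMul a (compound k X) T' := by
    intro T'
    refine Eq.trans ?_ ((map_perm_bijective σ).sum_comp fun S => a S * minor X S T')
    refine Finset.sum_congr rfl fun S _ => ?_
    change _ * minor (X.submatrix σ id) S T' = _
    rw [hε]
    ring
  refine mem_exteriorShift_iff.2 ⟨_, fun S hS => ?_, fun T' hT' => (key T').trans (h0 T' hT'),
    by rwa [key]⟩
  rw [ha, mul_zero]
  rintro ⟨S', hS', h⟩
  exact hS ((map_perm_bijective σ).injective h ▸ hS')

theorem exteriorShift_image (X : Matrix V V L) (σ : Equiv.Perm V) (G : Set (KSubset V k)) :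
    exteriorShift X (Set.powersetCard.map k σ.toEmbedding '' G) =
      exteriorShift (X.submatrix σ id) G := by
  refine (exteriorShift_image_subset X σ G).antisymm ?_
  have h := exteriorShift_image_subset (X.submatrix σ id) σ.symm
    (Set.powersetCard.map k σ.toEmbedding '' G)
  have h1 : Set.powersetCard.map k σ.symm.toEmbedding ''
      (Set.powersetCard.map k σ.toEmbedding '' G) = G := by
    rw [Set.image_image]
    refine (Set.image_congr fun S _ => ?_).trans (Set.image_id G)
    apply Subtype.ext
    ext x
    simp
  have h2 : (X.submatrix σ id).submatrix σ.symm id = X := by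
    ext i j
    simp
  rwa [h1, h2] at h

end Permutation

/-! ### Basis exchange and the vector matroid of a lex-segment -/

section Matroidal

variable {F L V : Type*} [Field F] [Field L] [Algebra F L] [LinearOrder V] [Fintype V] {k : ℕ}
  {X : Matrix V V L} {H : Set (KSubset V k)}

/-- Exchange `m` between the bases `H` and `σ(H)`. The incoming set must dominate `m`, because the
rest of `H` lies lexicographically before `m`; it then dominates `s` too, while everything in `H`
before `s` survives the exchange. -/
theorem IsGeneric.not_isMatroidal (hX : IsGeneric F X) (hH : IsShifted H) {m : KSubset V k}
    (hm : IsLexMax H m) {s : KSubset V k} (hs : s ∉ H) (hsm : LexLT s m) (σ : Equiv.Perm V)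
    (hσ : ∀ S ∈ H, CompLE m (Set.powersetCard.map k σ.toEmbedding S) →
      CompLE s (Set.powersetCard.map k σ.toEmbedding S)) : ¬ IsMatroidal X H := by
  rintro ⟨N, -, hN⟩
  have h1 : N.IsBase H := (hN H).2 (hX.exteriorShift_eq_of_isShifted hH)
  have h2 : N.IsBase (Set.powersetCard.map k σ.toEmbedding '' H) := (hN _).2
    ((exteriorShift_image X σ H).trans
      ((hX.submatrix σ σ.injective).exteriorShift_eq_of_isShifted hH))
  have hmσ : m ∉ Set.powersetCard.map k σ.toEmbedding '' H := by
    rintro ⟨S, hS, hSm⟩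
    have := hσ S hS (hSm ▸ CompLE.refl _)
    rw [hSm] at this
    exact hs (hH.mem_of_compLE hm.1 this)
  obtain ⟨_, ⟨⟨S, hS, rfl⟩, -⟩, hy⟩ := h1.exchange h2 ⟨hm.1, hmσ⟩
  have hshift := (hN _).1 hy
  have hmem := hm.1
  rw [← show exteriorShift X _ = H from hshift] at hmem
  obtain ⟨S', hS' | ⟨hS', hne⟩, hle⟩ := hX.exists_compLE_of_mem_exteriorShift hmem
  · rw [hS'] at hle
    refine hX.exteriorShift_ne_of_compLE hH hs (hσ S hS hle) (Set.mem_insert _ _) ?_ hshift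
    rintro T hT hTs
    refine Set.mem_insert_of_mem _ ⟨hT, ?_⟩
    rintro rfl
    exact LexLT.irrefl _ (hTs.trans hsm)
  · rcases hm.2 S' hS' with h | h
    · exact h.not_lexLE hle.lexLE
    · exact hne h

theorem row_basis_of_col_basis {m n : Type*} [Fintype m] [Fintype n] (M : Matrix m n L)
    (h : LinearIndependent L M.col ∧ Submodule.span L (Set.range M.col) = ⊤) :
    LinearIndependent L M.row ∧ Submodule.span L (Set.range M.row) = ⊤ := by
  have h1 : M.rank = Fintype.card n := by
    rw [← Matrix.rank_transpose]
    exact h.1.rank_matrix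
  have h2 : M.rank = Fintype.card m := by
    rw [Matrix.rank_eq_finrank_span_cols, h.2, finrank_top, Module.finrank_pi]
  rw [Matrix.rank_eq_finrank_span_row] at h1 h2
  exact ⟨linearIndependent_iff_card_eq_finrank_span.2 h2.symm,
    Submodule.eq_top_of_finrank_eq (by rw [h1, Module.finrank_pi])⟩

theorem linearIndependent_compoundColumn (G : Set (KSubset V k)) :
    LinearIndependent L fun T : exteriorShift X G => compoundColumn X G T := by
  let _ : Fintype G := Fintype.ofFinite G
  let _ : Fintype (exteriorShift X G) := Fintype.ofFinite _
  rw [Fintype.linearIndependent_iff]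
  intro b hb
  have hwf : WellFounded fun S T : KSubset V k => LexLT T S :=
    haveI : IsTrans (KSubset V k) fun S T => LexLT T S := ⟨fun _ _ _ h1 h2 => h2.trans h1⟩
    haveI : Std.Irrefl fun S T : KSubset V k => LexLT T S := ⟨LexLT.irrefl⟩
    Finite.wellFounded_of_trans_of_irrefl _
  rintro ⟨T, hT⟩
  revert hT
  refine hwf.induction (C := fun T => ∀ hT, b ⟨T, hT⟩ = 0) T ?_
  intro T ih hT
  obtain ⟨a, ha, h0, hne⟩ := mem_exteriorShift_iff.1 hT
  let f : (G → L) →ₗ[L] L := Fintype.linearCombination L (fun S : G => a S)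
  have haf : ∀ T', f (compoundColumn X G T') = Matrix.vecMul a (compound k X) T' := by
    intro T'
    rw [vecMul_compound_apply X G ha]
    simp [f, Fintype.linearCombination_apply, mul_comm]
  have h1 := congrArg f hb
  simp only [map_sum, map_smul, haf, smul_eq_mul, map_zero] at h1
  rw [Finset.sum_eq_single ⟨T, hT⟩] at h1
  · exact (mul_eq_zero.1 h1).resolve_right hne
  · rintro ⟨T', hT'⟩ - hTT'
    rcases lexLT_trichotomy T T' with h | h | h
    · rw [ih T' h, zero_mul]
    · exact absurd (Subtype.ext h.symm) hTT'
    · rw [h0 T' h, mul_zero]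
  · simp

/-- The whole compound matrix is invertible, so its columns still span after restriction to the rows
in `G`, and the greedy ones suffice. -/
theorem span_compoundColumn_eq_top (hX : X.det ≠ 0) (G : Set (KSubset V k)) :
    Submodule.span L (Set.range fun T : exteriorShift X G => compoundColumn X G T) = ⊤ := by
  classical
  rw [eq_top_iff]
  intro x _
  have h1 : compound k X * compound k X⁻¹ = 1 := by
    rw [← compound_mul, Matrix.mul_nonsing_inv _ (isUnit_iff_ne_zero.2 hX), compound_one]
  let x' : KSubset V k → L := fun S => if h : S ∈ G then x ⟨S, h⟩ else 0
  have h2 : Matrix.mulVec (compound k X) (Matrix.mulVec (compound k X⁻¹) x') = x' := by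
    rw [Matrix.mulVec_mulVec, h1, Matrix.one_mulVec]
  have h3 : x = ∑ T, Matrix.mulVec (compound k X⁻¹) x' T • compoundColumn X G T := by
    ext S
    have h4 := congrFun h2 S
    simp only [x', S.2, dif_pos] at h4
    rw [Finset.sum_apply, ← h4]
    exact Finset.sum_congr rfl fun T _ => mul_comm _ _
  rw [h3]
  refine Submodule.sum_mem _ fun T _ => Submodule.smul_mem _ _ ?_
  refine Submodule.span_mono ?_ (compoundColumn_mem_span X G T)
  rintro _ ⟨T', hT', rfl⟩
  exact ⟨⟨T', hT'.1⟩, rfl⟩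

/-- For an initial segment, being the greedy basis is the same as being a basis: every column
outside `H` comes after all of `H`. -/
theorem exteriorShift_eq_iff (hX : X.det ≠ 0) {T₀ : KSubset V k} (hH : H = {T | LexLE T T₀})
    (G : Set (KSubset V k)) :
    exteriorShift X G = H ↔ LinearIndependent L (fun T : H => compoundColumn X G T) ∧
      Submodule.span L (Set.range fun T : H => compoundColumn X G T) = ⊤ := by
  constructor
  · rintro rfl
    exact ⟨linearIndependent_compoundColumn G, span_compoundColumn_eq_top hX G⟩
  · rintro ⟨hli, hspan⟩
    ext T
    constructor
    · intro hT
      by_contra hTH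
      refine hT ?_
      have : compoundColumn X G T ∈ (⊤ : Submodule L (G → L)) := trivial
      rw [← hspan] at this
      refine Submodule.span_mono ?_ this
      rintro _ ⟨⟨T', hT'⟩, rfl⟩
      refine ⟨T', ?_, rfl⟩
      rw [hH] at hT' hTH
      exact hT'.trans_lt (lexLT_of_not_lexLE hTH)
    · intro hT hmem
      refine hli.notMem_span_image (s := {T' | LexLT T'.1 T}) (x := ⟨T, hT⟩)
        (fun h => LexLT.irrefl _ h) ?_
      refine Submodule.span_mono ?_ hmem
      rintro _ ⟨T', hT', rfl⟩
      refine ⟨⟨T', ?_⟩, hT', rfl⟩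
      rw [hH] at hT ⊢
      exact Or.inl ((show LexLE T' T from Or.inl hT').elim
        (fun h => by
          rcases hT with h' | rfl
          · exact h.trans h'
          · exact h) fun h => absurd (h ▸ hT') (LexLT.irrefl _))

theorem exchangeProperty_basis {ι W : Type*} [AddCommGroup W] [Module L W] (w : ι → W) :
    Matroid.ExchangeProperty fun B : Set ι =>
      LinearIndepOn L w B ∧ Submodule.span L (w '' B) = ⊤ := by
  rintro B₁ B₂ ⟨hli, hsp⟩ ⟨-, hsp₂⟩ a ⟨ha, ha₂⟩
  have hlia : LinearIndepOn L w (B₁ \ {a}) := hli.mono Set.sdiff_subset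
  have haU : w a ∉ Submodule.span L (w '' (B₁ \ {a})) := by
    have := hli
    rw [← Set.insert_eq_of_mem ha, ← Set.insert_sdiff_singleton] at this
    exact (linearIndepOn_insert (by simp)).1 this |>.2
  obtain ⟨b, hb, hbU⟩ : ∃ b ∈ B₂, w b ∉ Submodule.span L (w '' (B₁ \ {a})) := by
    by_contra! hc
    have h1 : Submodule.span L (w '' B₂) ≤ Submodule.span L (w '' (B₁ \ {a})) :=
      Submodule.span_le.2 (by rintro _ ⟨b, hb, rfl⟩; exact hc b hb)
    rw [hsp₂, top_le_iff] at h1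
    exact haU (h1 ▸ trivial)
  have hbB : b ∉ B₁ \ {a} := fun h => hbU (Submodule.subset_span ⟨b, h, rfl⟩)
  have hb₁ : b ∉ B₁ := fun h => hbB ⟨h, fun h' => ha₂ (h' ▸ hb)⟩
  refine ⟨b, ⟨hb, hb₁⟩, (linearIndepOn_insert hbB).2 ⟨hlia, hbU⟩, ?_⟩
  have hwa : w a ∈ Submodule.span L (insert (w b) (w '' (B₁ \ {a}))) := by
    refine mem_span_insert_exchange ?_ hbU
    rw [← Set.image_insert_eq, Set.insert_sdiff_singleton, Set.insert_eq_of_mem ha, hsp]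
    trivial
  rw [eq_top_iff, ← hsp, Submodule.span_le, Set.image_insert_eq]
  rintro _ ⟨c, hc, rfl⟩
  by_cases hca : c = a
  · exact hca ▸ hwa
  · exact Submodule.subset_span (Set.mem_insert_of_mem _ ⟨c, ⟨hc, hca⟩, rfl⟩)

theorem IsGeneric.isMatroidal (hX : IsGeneric F X) (hH : IsShifted H)
    (hinit : IsInitialLexSegment H) : IsMatroidal X H := by
  obtain ⟨T₀, hT₀⟩ := hinit
  let w : KSubset V k → H → L := fun S T => minor X S T
  have key : ∀ B : Set (KSubset V k), exteriorShift X B = H ↔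
      LinearIndepOn L w B ∧ Submodule.span L (w '' B) = ⊤ := by
    intro B
    let _ : Fintype B := Fintype.ofFinite B
    let _ : Fintype H := Fintype.ofFinite H
    rw [exteriorShift_eq_iff hX.det_ne_zero hT₀, Set.image_eq_range]
    -- Column and row bases of this matrix are equivalent, which moves the condition from `H` to
    -- `B`.
    let M : Matrix B H L := Matrix.of fun S T => minor X S.1 T.1
    exact ⟨row_basis_of_col_basis M, row_basis_of_col_basis M.transpose⟩
  refine ⟨Matroid.ofIsBaseOfFinite Set.finite_univ
    (fun B => LinearIndepOn L w B ∧ Submodule.span L (w '' B) = ⊤)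
    ⟨H, (key H).1 (hX.exteriorShift_eq_of_isShifted hH)⟩ (exchangeProperty_basis w)
    fun _ _ => Set.subset_univ _, rfl, fun B => (key B).symm⟩

end Matroidal

/-! ### Counting in `[n]` and interval reversals -/

section Vertices

variable {n k : ℕ}

theorem coe_mem_values {S : KSubset (Vertex n) k} {x : Vertex n} : (x : ℕ) ∈ values S ↔ x ∈ S.1 :=
  Finset.mem_map' _

theorem values_subset (S : KSubset (Vertex n) k) : values S ⊆ Finset.Icc 1 n := by
  intro x hx
  obtain ⟨y, -, rfl⟩ := Finset.mem_map.1 hx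
  exact y.2

theorem card_values (S : KSubset (Vertex n) k) : (values S).card = k :=
  (Finset.card_map _).trans S.2

theorem exists_values_eq {M : Finset ℕ} (hM : M ⊆ Finset.Icc 1 n) (hk : M.card = k) :
    ∃ S : KSubset (Vertex n) k, values S = M := by
  have h : (M.subtype (· ∈ Finset.Icc 1 n)).map (Function.Embedding.subtype _) = M :=
    Finset.subtype_map_of_mem hM
  exact ⟨⟨M.subtype (· ∈ Finset.Icc 1 n), by
    rw [Set.powersetCard.mem_iff, ← hk, ← congrArg Finset.card h, Finset.card_map]⟩, h⟩

theorem card_filter_values (S : KSubset (Vertex n) k) (v : Vertex n) :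
    ((values S).filter (· ≤ (v : ℕ))).card = (S.1.filter (· ≤ v)).card := by
  rw [values, Finset.filter_map, Finset.card_map]
  rfl

theorem compLE_iff {S T : KSubset (Vertex n) k} :
    CompLE S T ↔ ∀ v, ((values T).filter (· ≤ v)).card ≤ ((values S).filter (· ≤ v)).card := by
  constructor
  · intro h v
    by_cases hv : v ∈ Finset.Icc 1 n
    · have := h ⟨v, hv⟩
      rwa [← card_filter_values, ← card_filter_values] at this
    · rw [Finset.mem_Icc, not_and_or, not_le, not_le] at hv
      rcases hv with hv | hv
      · rw [Finset.filter_false_of_mem, Finset.card_empty]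
        · exact Nat.zero_le _
        · intro x hx
          have := (Finset.mem_Icc.1 (values_subset T hx)).1
          omega
      · rw [Finset.filter_true_of_mem (s := values S), card_values]
        · exact (Finset.card_filter_le _ _).trans (card_values T).le
        · intro x hx
          have := (Finset.mem_Icc.1 (values_subset S hx)).2
          omega
  · intro h v
    rw [← card_filter_values, ← card_filter_values]
    exact h v

theorem lexLT_iff {S T : KSubset (Vertex n) k} :
    LexLT S T ↔ ∃ a ∈ values S, a ∉ values T ∧ ∀ b < a, (b ∈ values S ↔ b ∈ values T) := by
  constructor
  · rintro ⟨a, haS, haT, h⟩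
    refine ⟨a, coe_mem_values.2 haS, fun h' => haT (coe_mem_values.1 h'), fun b hb => ?_⟩
    by_cases hbn : b ∈ Finset.Icc 1 n
    · exact (coe_mem_values (x := ⟨b, hbn⟩)).trans ((h ⟨b, hbn⟩ hb).trans coe_mem_values.symm)
    · exact iff_of_false (fun h' => hbn (values_subset S h')) fun h' => hbn (values_subset T h')
  · rintro ⟨a, haS, haT, h⟩
    refine ⟨⟨a, values_subset S haS⟩, coe_mem_values.1 haS, fun h' => haT (coe_mem_values.2 h'),
      fun b hb => ?_⟩
    rw [← coe_mem_values, ← coe_mem_values]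
    exact h b hb

/-- The permutation of `[n]` reversing the interval `[c, N]` and fixing everything else. -/
def reverseIcc (n c N : ℕ) (hc : 1 ≤ c) (hN : N ≤ n) : Equiv.Perm (Vertex n) :=
  Function.Involutive.toPerm
    (fun x => ⟨if c ≤ x.1 ∧ x.1 ≤ N then c + N - x.1 else x.1, by
      have := Finset.mem_Icc.1 x.2
      rw [Finset.mem_Icc]
      split_ifs <;> omega⟩) fun x => by
    apply Subtype.ext
    dsimp only
    split_ifs <;> omega

theorem coe_reverseIcc {c N : ℕ} (hc : 1 ≤ c) (hN : N ≤ n) (x : Vertex n) :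
    (reverseIcc n c N hc hN x : ℕ) = if c ≤ x.1 ∧ x.1 ≤ N then c + N - x.1 else x.1 := rfl

theorem mem_values_map_reverseIcc {c N : ℕ} (hc : 1 ≤ c) (hN : N ≤ n) (S : KSubset (Vertex n) k)
    (x : ℕ) : x ∈ values (Set.powersetCard.map k (reverseIcc n c N hc hN).toEmbedding S) ↔
      (if c ≤ x ∧ x ≤ N then c + N - x else x) ∈ values S := by
  simp only [values, Set.powersetCard.val_map, Finset.mem_map, Function.Embedding.subtype_apply,
    Equiv.coe_toEmbedding, exists_exists_and_eq_and, coe_reverseIcc]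
  constructor
  · rintro ⟨y, hy, rfl⟩
    refine ⟨y, hy, ?_⟩
    split_ifs <;> omega
  · rintro ⟨y, hy, hyx⟩
    refine ⟨y, hy, ?_⟩
    rw [hyx]
    split_ifs <;> omega

/-- If `S` precedes `M` lexicographically, agrees below `c` with a set that dominates `M`
componentwise, and `M` contains `[c, e]`, then `S` and `M` agree up to `e`. -/
theorem mem_iff_of_le_of_lex {M S Y : Finset ℕ} {c e : ℕ}
    (hlex : S = M ∨ ∃ a ∈ S, a ∉ M ∧ ∀ b < a, (b ∈ S ↔ b ∈ M))
    (hY : ∀ v, (Y.filter (· ≤ v)).card ≤ (M.filter (· ≤ v)).card)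
    (hYS : ∀ x < c, (x ∈ Y ↔ x ∈ S)) (hM : ∀ x, c ≤ x → x ≤ e → x ∈ M) {x : ℕ} (hx : x ≤ e) :
    x ∈ S ↔ x ∈ M := by
  rcases hlex with rfl | ⟨a, haS, haM, h⟩
  · rfl
  have hca : c ≤ a := by
    by_contra! hlt
    have h1 := filter_card_eq_add_one (S := Y) (T := M) ((hYS a hlt).2 haS) haM
      fun b hb => (hYS b (hb.trans hlt)).trans (h b hb)
    have := hY a
    omega
  have hea : e < a := by
    by_contra! hle
    exact haM (hM a hca hle)
  exact h x (hx.trans_lt hea)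

theorem lex_values {S T : KSubset (Vertex n) k} (h : LexLE S T) : values S = values T ∨
    ∃ a ∈ values S, a ∉ values T ∧ ∀ b < a, (b ∈ values S ↔ b ∈ values T) :=
  h.elim (fun h => Or.inr (lexLT_iff.1 h)) fun h => Or.inl (congrArg values h)

theorem card_filter_le_of_injOn {Y s : Finset ℕ} (f : ℕ → ℕ) (hf : ∀ y ∈ Y, f y ∈ s)
    (hle : ∀ y, f y ≤ y) (hinj : Set.InjOn f Y) (v : ℕ) :
    (Y.filter (· ≤ v)).card ≤ (s.filter (· ≤ v)).card := by
  refine Finset.card_le_card_of_injOn f (fun y hy => ?_)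
    (hinj.mono (Finset.coe_subset.2 (Finset.filter_subset _ _)))
  rw [Finset.mem_coe, Finset.mem_filter] at hy ⊢
  exact ⟨hf y hy.1, (hle y).trans hy.2⟩

/-- The final run of consecutive elements of a set of positive integers. -/
theorem exists_final_run {M : Finset ℕ} (hM : M.Nonempty) (h0 : 0 ∉ M) :
    ∃ (A : Finset ℕ) (c l : ℕ), 1 ≤ c ∧ (∀ x ∈ A, x + 1 < c) ∧ M = A ∪ Finset.Icc c (c + l) := by
  classical
  set e := M.max' hM with he
  have hex : ∃ c, Finset.Icc c e ⊆ M := ⟨e, by simpa using M.max'_mem hM⟩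
  set c := Nat.find hex with hc
  have hcM : Finset.Icc c e ⊆ M := Nat.find_spec hex
  have hce : c ≤ e := Nat.find_min' hex (by simpa using M.max'_mem hM)
  refine ⟨M.filter (· < c), c, e - c, ?_, fun x hx => ?_, ?_⟩
  · by_contra! hlt
    exact h0 (hcM (Finset.mem_Icc.2 ⟨by omega, by omega⟩))
  · obtain ⟨hxM, hxc⟩ := Finset.mem_filter.1 hx
    by_contra! hle
    refine Nat.find_min hex hxc fun y hy => ?_
    rw [Finset.mem_Icc] at hy
    by_cases hyx : y = x
    · exact hyx ▸ hxM
    · exact hcM (Finset.mem_Icc.2 ⟨by omega, hy.2⟩)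
  · ext x
    rw [Nat.add_sub_cancel' hce, Finset.mem_union, Finset.mem_filter]
    constructor
    · intro hx
      have := M.le_max' x hx
      rcases lt_or_ge x c with h | h
      · exact Or.inl ⟨hx, h⟩
      · exact Or.inr (Finset.mem_Icc.2 ⟨h, this⟩)
    · rintro (h | h)
      · exact h.1
      · exact hcM h

variable {F L : Type*} [Field F] [Field L] [Algebra F L] {X : Matrix (Vertex n) (Vertex n) L}
  {H : Set (KSubset (Vertex n) k)} {m : KSubset (Vertex n) k}

/-- The reversal of `[c, N]` fixes everything below `c`. If it carries `S ∈ H` above `m`, then `S`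
agrees with `m` up to `c + l`, so the run `[c, c + l]` is sent to `[N - l, N]`. Only the domination
of `s` is left to `hdom`. -/
theorem not_isMatroidal_of_run (hX : IsGeneric F X) (hH : IsShifted H) (hm : IsLexMax H m)
    {A : Finset ℕ} {c l N : ℕ} (hc : 1 < c) (hA : ∀ x ∈ A, x + 1 < c) (hlN : c + l ≤ N)
    (hN : N ≤ n) (hmA : ∀ x ≤ c + l, (x ∈ values m ↔ x ∈ A ∨ c ≤ x)) {s : KSubset (Vertex n) k}
    (hs : s ∉ H) (hsA : ∀ x < c, (x ∈ values s ↔ x ∈ A ∨ x = c - 1))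
    (hdom : ∀ Y : Finset ℕ, Y ⊆ Finset.Icc 1 n → Y.card = k →
      (∀ v, (Y.filter (· ≤ v)).card ≤ ((values m).filter (· ≤ v)).card) →
      (∀ x < c, (x ∈ Y ↔ x ∈ A)) → Finset.Icc (N - l) N ⊆ Y →
      ∀ v, (Y.filter (· ≤ v)).card ≤ ((values s).filter (· ≤ v)).card) :
    ¬ IsMatroidal X H := by
  refine hX.not_isMatroidal hH hm hs ?_ (reverseIcc n c N hc.le hN) fun S hS hmS => ?_
  · refine lexLT_iff.2 ⟨c - 1, (hsA _ (by omega)).2 (Or.inr rfl), fun h => ?_, fun b hb => ?_⟩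
    · rcases (hmA _ (by omega)).1 h with h | h
      · have := hA _ h
        omega
      · omega
    · rw [hsA b (by omega), hmA b (by omega)]
      refine or_congr_right ?_
      omega
  · have hlow : ∀ x < c, (x ∈ values (Set.powersetCard.map k
        (reverseIcc n c N hc.le hN).toEmbedding S) ↔ x ∈ values S) := by
      intro x hx
      rw [mem_values_map_reverseIcc, if_neg (by omega)]
    have hagree : ∀ x ≤ c + l, (x ∈ values S ↔ x ∈ values m) := fun x hx =>
      mem_iff_of_le_of_lex (lex_values (hm.2 S hS)) (compLE_iff.1 hmS) hlow
        (fun x hx hx' => (hmA x hx').2 (Or.inr hx)) hx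
    refine compLE_iff.2 (hdom _ (values_subset _) (card_values _) (compLE_iff.1 hmS)
      (fun x hx => ?_) fun x hx => ?_)
    · rw [hlow x hx, hagree x (by omega), hmA x (by omega)]
      exact or_iff_left (by omega)
    · rw [Finset.mem_Icc] at hx
      rw [mem_values_map_reverseIcc, if_pos (by omega), hagree _ (by omega), hmA _ (by omega)]
      exact Or.inr (by omega)

theorem isInitialLexSegment_of_compLE (hH : IsShifted H) (hm : IsLexMax H m)
    (h : ∀ S, LexLE S m → CompLE S m) : IsInitialLexSegment H :=
  ⟨m, Set.Subset.antisymm hm.2 fun S hS => hH.mem_of_compLE hm.1 (h S hS)⟩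

/-- A set lexicographically before `m` contains `[1, e]` and first differs at some `a` strictly
between `e` and `d`; the count there exhausts all `k` elements. -/
theorem isInitialLexSegment_of_values_eq_union_singleton (hH : IsShifted H) (hm : IsLexMax H m)
    {e d : ℕ} (hed : e < d) (hv : values m = Finset.Icc 1 e ∪ {d}) : IsInitialLexSegment H := by
  refine isInitialLexSegment_of_compLE hH hm fun S hS => compLE_iff.2 fun v => ?_
  have hagree : ∀ x ≤ e, (x ∈ values S ↔ x ∈ values m) := fun x hx =>
    mem_iff_of_le_of_lex (Y := values m) (c := 1) (lex_values hS) (fun _ => le_rfl)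
      (fun x hx => iff_of_false
        (fun h => by have := Finset.mem_Icc.1 (values_subset m h); omega)
        (fun h => by have := Finset.mem_Icc.1 (values_subset S h); omega))
      (fun x hx hx' => by rw [hv]; simp; omega) hx
  rcases lt_or_ge v d with hvd | hvd
  · refine Finset.card_le_card fun x hx => ?_
    rw [Finset.mem_filter] at hx ⊢
    refine ⟨(hagree x ?_).2 hx.1, hx.2⟩
    have := hx.1
    rw [hv] at this
    simp at this
    omega
  · rcases lex_values hS with h | ⟨a, haS, ham, hab⟩
    · rw [h]
    have h1 := filter_card_eq_add_one haS ham hab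
    have h2 : ∀ u, d ≤ u → (values m).filter (· ≤ u) = values m := fun u hu =>
      Finset.filter_true_of_mem fun x hx => by
        rw [hv] at hx
        simp at hx
        omega
    have h3 := Finset.card_filter_le (values S) (· ≤ a)
    have h4 := card_values m
    rw [card_values] at h3
    have had : a < d := by
      by_contra! hda
      rw [h2 a hda] at h1
      omega
    have hea : e < a := by
      by_contra! hae
      exact ham ((hagree a hae).1 haS)
    have h5 : Finset.Icc 1 e ⊆ (values m).filter (· ≤ a) := fun x hx => by
      rw [Finset.mem_filter, hv]
      simp at hx ⊢
      omega
    have h6 := Finset.card_le_card h5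
    have h7 : (values m).card ≤ e + 1 := by
      rw [hv]
      refine (Finset.card_union_le _ _).trans ?_
      simp
    have h8 : ((values S).filter (· ≤ a)).card ≤ ((values S).filter (· ≤ v)).card :=
      Finset.card_le_card (Finset.monotone_filter_right _ fun x _ hx =>
        hx.trans (had.le.trans hvd))
    rw [h2 v hvd]
    rw [Nat.card_Icc] at h6
    omega

/-- Before `n - r`, the elements of `m` lie in the common part `[1, e]`; from there on `m` contains
everything, so no set has more elements above a given `v`. -/
theorem isInitialLexSegment_of_values_eq_union_Icc (hH : IsShifted H) (hm : IsLexMax H m)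
    {e r : ℕ} (hv : values m = Finset.Icc 1 e ∪ Finset.Icc (n - r) n) :
    IsInitialLexSegment H := by
  refine isInitialLexSegment_of_compLE hH hm fun S hS => compLE_iff.2 fun v => ?_
  have hagree : ∀ x ≤ e, (x ∈ values S ↔ x ∈ values m) := fun x hx =>
    mem_iff_of_le_of_lex (Y := values m) (c := 1) (lex_values hS) (fun _ => le_rfl)
      (fun x hx => iff_of_false
        (fun h => by have := Finset.mem_Icc.1 (values_subset m h); omega)
        (fun h => by have := Finset.mem_Icc.1 (values_subset S h); omega))
      (fun x hx hx' => by rw [hv]; simp; omega) hx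
  rcases lt_or_ge v (n - r) with hvr | hvr
  · refine Finset.card_le_card fun x hx => ?_
    rw [Finset.mem_filter] at hx ⊢
    refine ⟨(hagree x ?_).2 hx.1, hx.2⟩
    have := hx.1
    rw [hv] at this
    simp at this
    omega
  · have h1 := Finset.card_filter_add_card_filter_not (s := values m) (· ≤ v)
    have h2 := Finset.card_filter_add_card_filter_not (s := values S) (· ≤ v)
    have h3 : ((values S).filter fun x => ¬ x ≤ v).card ≤
        ((values m).filter fun x => ¬ x ≤ v).card := by
      refine Finset.card_le_card fun x hx => ?_
      rw [Finset.mem_filter] at hx ⊢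
      refine ⟨?_, hx.2⟩
      have := Finset.mem_Icc.1 (values_subset S hx.1)
      rw [hv]
      simp
      omega
    rw [card_values] at h1 h2
    omega

end Vertices

/-! ### The two shapes of the lexicographic maximum -/

section Main

variable {n k : ℕ} {F L : Type*} [Field F] [Field L] [Algebra F L]
  {X : Matrix (Vertex n) (Vertex n) L} {H : Set (KSubset (Vertex n) k)}
  {m : KSubset (Vertex n) k}

theorem card_union_Icc {A : Finset ℕ} {a b c : ℕ} (hA : ∀ x ∈ A, x < a) (hc : b + 1 - a = c) :
    (A ∪ Finset.Icc a b).card = A.card + c := by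
  rw [Finset.card_union_of_disjoint, Nat.card_Icc, hc]
  refine Finset.disjoint_left.2 fun x hx hx' => ?_
  have := hA x hx
  have := Finset.mem_Icc.1 hx'
  omega

theorem card_union_singleton_union_Icc {A : Finset ℕ} {a b c d : ℕ} (hA : ∀ x ∈ A, x < c)
    (hca : c < a) (hd : b + 1 - a = d) :
    (A ∪ {c} ∪ Finset.Icc a b).card = A.card + 1 + d := by
  rw [card_union_Icc (fun x hx => ?_) hd, ← Finset.Icc_self,
    card_union_Icc (c := 1) (fun x hx => hA x hx) (by omega)]
  rw [Finset.mem_union, Finset.mem_singleton] at hx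
  rcases hx with hx | rfl
  · exact (hA x hx).trans hca
  · exact hca

theorem not_isMatroidal_of_max_ne (hX : IsGeneric F X) (hH : IsShifted H) (hm : IsLexMax H m)
    (hs : ∀ s ∈ H, ¬ IsSpecialSet n (values m) (values s)) {A : Finset ℕ} {c l d : ℕ}
    (hc : 1 < c) (hA : ∀ x ∈ A, x + 1 < c) (hd : c + l < d) (hdn : d < n)
    (hv : values m = A ∪ Finset.Icc c (c + l) ∪ {d}) : ¬ IsMatroidal X H := by
  have hk : k = A.card + l + 2 := by
    rw [← card_values m, hv, ← Finset.Icc_self, card_union_Icc (c := 1) _ (by omega),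
      card_union_Icc (c := l + 1) (fun x hx => by have := hA x hx; omega) (by omega)]
    · omega
    · intro x hx
      have := hA x
      grind
  have hA1 : ∀ x ∈ A, 1 ≤ x := fun x hx =>
    (Finset.mem_Icc.1 (values_subset m (by rw [hv]; simp [hx]))).1
  obtain ⟨s, hsv⟩ := exists_values_eq (n := n) (k := k)
    (M := A ∪ {c - 1} ∪ Finset.Icc (n - (l + 1)) (n - 1))
    (fun x hx => by
      have := hA x
      have := hA1 x
      grind)
    (by
      rw [card_union_singleton_union_Icc (d := l + 1) (fun x hx => by have := hA x hx; omega)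
        (by omega) (by omega)]
      omega)
  have hsH : s ∉ H := fun h => hs s h (by
    rw [hsv, hv]
    exact .maxNe A c l d hc hA hd hdn)
  refine not_isMatroidal_of_run hX hH hm hc hA (N := n) (l := l) (by omega) le_rfl
    (fun x hx => ?_) hsH (fun x hx => ?_) fun Y hYn hYk _ hYA hYl => ?_
  · rw [hv]
    have := hA x
    grind
  · rw [hsv]
    have := hA x
    grind
  · rw [hsv]
    -- Since `k = |A| + l + 2`, the sets `A` and `[n - l, n]` leave room for only one further
    -- element.
    have hmid : ∀ y ∈ Y, ∀ z ∈ Y, c ≤ y → y < n - l → c ≤ z → z < n - l → y = z := by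
      intro y hy z hz hcy hyn hcz hzn
      by_contra hne
      have h1 : insert y (A ∪ {z} ∪ Finset.Icc (n - l) n) ⊆ Y := by
        intro x hx
        have := hYA x
        have := hA x
        have := @hYl x
        grind
      have h2 := Finset.card_le_card h1
      rw [Finset.card_insert_of_notMem (by have := hA y; grind),
        card_union_singleton_union_Icc (d := l + 1) (fun x hx => by have := hA x hx; omega)
          hzn (by omega)] at h2
      omega
    -- The middle element drops to `c - 1` and the top block moves down by one.
    refine card_filter_le_of_injOn
      (fun y => if y < c then y else if y < n - l then c - 1 else y - 1) (fun y hy => ?_)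
      (fun y => ?_) fun y hy z hz hyz => ?_
    · have := hYA y
      have := Finset.mem_Icc.1 (hYn hy)
      grind
    · split_ifs <;> omega
    · have h1 := hmid y hy z hz
      have h2 : y < c → y + 1 < c := fun h => hA y ((hYA y h).1 hy)
      have h3 : z < c → z + 1 < c := fun h => hA z ((hYA z h).1 hz)
      dsimp only at hyz
      split_ifs at hyz <;> omega

theorem not_isMatroidal_of_max_eq (hX : IsGeneric F X) (hH : IsShifted H) (hm : IsLexMax H m)
    (hs : ∀ s ∈ H, ¬ IsSpecialSet n (values m) (values s)) {A : Finset ℕ} {c l r : ℕ}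
    (hc : 1 < c) (hA : ∀ x ∈ A, x + 1 < c) (hr : c + l + 1 + r < n)
    (hv : values m = A ∪ Finset.Icc c (c + l) ∪ Finset.Icc (n - r) n) : ¬ IsMatroidal X H := by
  have hAl : (A ∪ Finset.Icc c (c + l)).card = A.card + (l + 1) :=
    card_union_Icc (fun x hx => by have := hA x hx; omega) (by omega)
  have hk : k = A.card + l + r + 2 := by
    rw [← card_values m, hv, card_union_Icc (c := r + 1) _ (by omega), hAl]
    · omega
    · intro x hx
      have := hA x
      grind
  have hA1 : ∀ x ∈ A, 1 ≤ x := fun x hx =>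
    (Finset.mem_Icc.1 (values_subset m (by rw [hv]; simp [hx]))).1
  obtain ⟨s, hsv⟩ := exists_values_eq (n := n) (k := k)
    (M := A ∪ {c - 1} ∪ Finset.Icc (n - r - l) n)
    (fun x hx => by
      have := hA x
      have := hA1 x
      grind)
    (by
      rw [card_union_singleton_union_Icc (d := l + r + 1)
        (fun x hx => by have := hA x hx; omega) (by omega) (by omega)]
      omega)
  have hsH : s ∉ H := fun h => hs s h (by
    rw [hsv, hv]
    exact .maxEq A c l r hc hA hr)
  refine not_isMatroidal_of_run hX hH hm hc hA (N := n - r - 1) (l := l) (by omega) (by omega)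
    (fun x hx => ?_) hsH (fun x hx => ?_) fun Y hYn hYk hYm hYA hYl => ?_
  · rw [hv]
    have := hA x
    grind
  · rw [hsv]
    have := hA x
    grind
  · rw [hsv]
    -- Up to `n - r - 1`, `m` has only `|A| + l + 1` elements. Domination allows `Y` no more, and
    -- the forced part already has that many.
    have hYN : Y.filter (· ≤ n - r - 1) = A ∪ Finset.Icc (n - r - 1 - l) (n - r - 1) := by
      symm
      refine Finset.eq_of_subset_of_card_le (fun x hx => ?_) ?_
      · have := hYA x
        have := hA x
        have := @hYl x
        grind
      · refine (hYm _).trans ?_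
        rw [card_union_Icc (c := l + 1) (fun x hx => by have := hA x hx; omega) (by omega), ← hAl]
        refine Finset.card_le_card fun x hx => ?_
        rw [hv] at hx
        grind
    have hY : ∀ y ∈ Y, c ≤ y → n - r - 1 - l ≤ y := by
      intro y hy hcy
      by_contra! hlt
      have : y ∈ Y.filter (· ≤ n - r - 1) := Finset.mem_filter.2 ⟨hy, by omega⟩
      rw [hYN] at this
      have := hA y
      grind
    -- Only the least element of the moved run, `n - r - 1 - l`, has to drop to `c - 1`.
    refine card_filter_le_of_injOn
      (fun y => if y < c then y else if y ≤ n - r - 1 - l then c - 1 else y) (fun y hy => ?_)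
      (fun y => ?_) fun y hy z hz hyz => ?_
    · have := hYA y
      have := Finset.mem_Icc.1 (hYn hy)
      grind
    · split_ifs <;> omega
    · have h1 := hY y hy
      have h1' := hY z hz
      have h2 : y < c → y + 1 < c := fun h => hA y ((hYA y h).1 hy)
      have h3 : z < c → z + 1 < c := fun h => hA z ((hYA z h).1 hz)
      dsimp only at hyz
      split_ifs at hyz <;> omega

theorem isInitialLexSegment_of_isMatroidal (hk : 2 ≤ k) (hX : IsGeneric F X) (hH : IsShifted H)
    (hm : IsLexMax H m) (hs : ∀ s ∈ H, ¬ IsSpecialSet n (values m) (values s))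
    (hmat : IsMatroidal X H) : IsInitialLexSegment H := by
  have hpos : ∀ {M : Finset ℕ}, M ⊆ values m → 0 ∉ M := fun hM h0 => by
    have := Finset.mem_Icc.1 (values_subset m (hM h0))
    omega
  have hcard := card_values m
  have hne : (values m).Nonempty := Finset.card_pos.1 (by omega)
  set d := (values m).max' hne
  have hdm : d ∈ values m := Finset.max'_mem _ hne
  have hdmax : ∀ x ∈ values m, x ≤ d := fun x hx => Finset.le_max' _ x hx
  have hdn := (Finset.mem_Icc.1 (values_subset m hdm)).2
  have hempty : ∀ {A : Finset ℕ}, (∀ x ∈ A, x + 1 < 1) → A = ∅ := fun hA =>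
    Finset.eq_empty_of_forall_notMem fun x hx => by have := hA x hx; omega
  rcases hdn.lt_or_eq with hlt | heq
  · obtain ⟨A, c, l, hc, hA, hv⟩ := exists_final_run (M := (values m).erase d)
      (Finset.card_pos.1 (by rw [Finset.card_erase_of_mem hdm]; omega))
      (hpos (Finset.erase_subset _ _))
    have hcd : c + l < d := by
      have h1 : c + l ∈ (values m).erase d := by rw [hv]; simp
      exact lt_of_le_of_ne (hdmax _ (Finset.mem_of_mem_erase h1)) (Finset.ne_of_mem_erase h1)
    have hv' : values m = A ∪ Finset.Icc c (c + l) ∪ {d} := by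
      rw [← hv, Finset.union_comm, ← Finset.insert_eq, Finset.insert_erase hdm]
    rcases hc.eq_or_lt with rfl | hc
    · rw [hempty hA, Finset.empty_union] at hv'
      exact isInitialLexSegment_of_values_eq_union_singleton hH hm hcd hv'
    · exact absurd hmat (not_isMatroidal_of_max_ne hX hH hm hs hc hA hcd hlt hv')
  · obtain ⟨A, c', r, hc', hA, hv⟩ := exists_final_run hne (hpos subset_rfl)
    have hcr : c' + r = n := by
      have h1 : c' + r ≤ d := hdmax _ (by rw [hv]; simp)
      have h2 : d ∈ A ∪ Finset.Icc c' (c' + r) := hv ▸ hdm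
      have := hA d
      grind
    obtain rfl : c' = n - r := by omega
    rw [hcr] at hv
    rcases A.eq_empty_or_nonempty with rfl | hAne
    · refine isInitialLexSegment_of_values_eq_union_Icc hH hm (e := 0) (r := r) ?_
      rw [hv]
      rfl
    obtain ⟨A', c, l, hc, hA', rfl⟩ := exists_final_run hAne
      (hpos (by rw [hv]; exact Finset.subset_union_left))
    have hcl := hA (c + l) (by simp)
    rcases hc.eq_or_lt with rfl | hc
    · rw [hempty hA', Finset.empty_union] at hv
      exact isInitialLexSegment_of_values_eq_union_Icc hH hm hv
    · exact absurd hmat (not_isMatroidal_of_max_eq hX hH hm hs hc hA' (by omega) hv)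

end Main

end ExteriorShifting

theorem theorem1p3 {F L : Type*} [Field F] [Field L] [Algebra F L] (n k : ℕ) (hk : 4 ≤ k)
    (X : Matrix (ExteriorShifting.Vertex n) (ExteriorShifting.Vertex n) L)
    (hX : ExteriorShifting.IsGeneric F X)
    (H : Set (ExteriorShifting.KSubset (ExteriorShifting.Vertex n) k))
    (hH : ExteriorShifting.IsShifted H)
    (m : ExteriorShifting.KSubset (ExteriorShifting.Vertex n) k)
    (hm : ExteriorShifting.IsLexMax H m)
    (hs : ∀ s ∈ H, ¬ ExteriorShifting.IsSpecialSet n (ExteriorShifting.values m)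
      (ExteriorShifting.values s)) :
    ExteriorShifting.IsMatroidal X H ↔ ExteriorShifting.IsInitialLexSegment H :=
  ⟨ExteriorShifting.isInitialLexSegment_of_isMatroidal (by omega) hX hH hm hs,
    hX.isMatroidal hH⟩
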